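/- Let $n\ge 1$. Let $P_n$ be the path graph with vertex set $\{1,\dots,n\}$ and edges $\{i,i+1\}$ ($1\le i<n$), and let the fan graph $F_n$ be obtained from $P_n$ by adding a vertex $0$, the sink, adjacent to all vertices of $P_n$. A configuration on $F_n$ is a vector $c=(c_1,\dots,c_n)$ of non-negative integers. It is stable if $c_i<\deg(i)$ for all $i\in\{1,\dots,n\}$. Toppling a vertex $i\ge 1$ with $c_i\ge\deg(i)$ removes $\deg(i)$ grains from $i$ and adds one grain to each neighbour of $i$ other than the sink; the stabilisation of a configuration is the stable configuration reached by successively toppling such vertices. Fix a probability distribution $\mu$ on $\{1,\dots,n\}$ with $\mu_i>0$ for all $i$, and consider the Markov chain on stable configurations which at each step adds one grain at an independent random vertex with distribution $\mu$ and then stabilises (the Abelian sandpile model). Let $\mathrm{Rec}(F_n)$ be the set of recurrent states of this chain, i.e. of the stable configurations $c$ that the chain started at $c$ almost surely visits infinitely often. The level of $c$ is $\mathrm{level}(c)=\sum_{i=1}^n c_i+\deg(0)-|E(F_n)|$. For a configuration $c$, orient the edges $\{k,k+1\}$, $0\le k\le n-1$, of the path $0,1,\dots,n$ successively as follows. The edge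 $\{0,1\}$ is directed leftwards (from $1$ to $0$). For $1\le i\le n-1$: if $\{i-1,i\}$ is directed leftwards, then $\{i,i+1\}$ is directed rightwards if $c_i=0$ and leftwards otherwise; if $\{i-1,i\}$ is directed rightwards, then $\{i,i+1\}$ is directed leftwards if $c_i=2$ and rightwards otherwise. A vertex $i$ is marked if $\{i-1,i\}$ is directed leftwards and either $i<n$ and $c_i=2$, or $i=n$ and $c_n=1$. Let $\Phi_F(c)=w_1\cdots w_{n-1}$ be the word over $\{L^u,L^m,R\}$ with $w_i=R$ if $\{i,i+1\}$ is directed rightwards, $w_i=L^m$ if $\{i,i+1\}$ is directed leftwards and $i+1$ is marked, and $w_i=L^u$ otherwise. In this word no $L^m$ is immediately followed by $R$. For any word $w$ of length $n-1$ with this property, let $T(w)$ be the subgraph of $P_n$ with vertex set $\{i\in\{1,\dots,n-1\}: w_i\in\{L^u,L^m\}\}\cup\{n\}$ and edge set $\{\{i,i+1\}: w_i=L^m\}$. Then $T\circ\Phi_F$ is a bijection from $\mathrm{Rec}(F_n)$ to the set of subgraphs of $P_n$ whose vertex set contains $n$ (a subgraph is a set of vertices together with a set of edges of $P_n$ between them).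 Moreover, for every $c\in\mathrm{Rec}(F_n)$, $\mathrm{level}(c)$ is equal to the number of edges of $T(\Phi_F(c))$. -/

import Mathlib

namespace Sandpile

section ASM

variable {V : Type*} [Fintype V] [DecidableEq V]

/-- Configurations on a graph with vertex set `Option V`, whose sink is `none`: every non-sink
vertex carries a number of grains. -/
abbrev Config (V : Type*) := V → ℕ

/-- A configuration is stable if every non-sink vertex has fewer grains than its degree. -/
def Stable (G : SimpleGraph (Option V)) [DecidableRel G.Adj] (c : Config V) : Prop :=
  ∀ v, c v < G.degree (some v)

/-- Toppling the vertex `v`: it loses `deg v` grains and each non-sink neighbour gains one. It is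
only applied to an unstable `v`, where the natural-number subtraction is exact. -/
def topple (G : SimpleGraph (Option V)) [DecidableRel G.Adj] (v : V) (c : Config V) : Config V :=
  fun u => (if u = v then c u - G.degree (some v) else c u)
    + (if G.Adj (some v) (some u) then 1 else 0)

/-- One legal toppling: some unstable vertex of `c` topples, which gives `c'`. -/
def ToppleStep (G : SimpleGraph (Option V)) [DecidableRel G.Adj] (c c' : Config V) : Prop :=
  ∃ v, G.degree (some v) ≤ c v ∧ c' = topple G v c

/-- `c'` is stable and is reached from `c` by successively toppling unstable vertices. -/
def StabilisesTo (G : SimpleGraph (Option V)) [DecidableRel G.Adj] (c c' : Config V) : Prop :=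
  Relation.ReflTransGen (ToppleStep G) c c' ∧ Stable G c'

open Classical in
/-- The stabilisation of `c`. On a connected graph a stable configuration reached by legal
topplings exists and is unique; the value `c` in the other case is a dummy. -/
noncomputable def stabilisation (G : SimpleGraph (Option V)) [DecidableRel G.Adj]
    (c : Config V) : Config V :=
  if h : ∃ c', StabilisesTo G c c' then h.choose else c

/-- The trajectory of the sandpile Markov chain from `c`, when the grain added at step `k` falls
on the vertex `ω k`: at each step add that grain and stabilise. -/
noncomputable def chain (G : SimpleGraph (Option V)) [DecidableRel G.Adj] (c : Config V)
    (ω : ℕ → V) : ℕ → Config V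
  | 0 => c
  | k + 1 => stabilisation G (chain G c ω k + Pi.single (ω k) 1)

open MeasureTheory Filter in
/-- The recurrent configurations of the Abelian sandpile model on `G`, where the grains are added
at independent vertices with distribution `μ`: the stable configurations `c` that the Markov chain
started at `c` almost surely visits infinitely often. -/
def ASMRec (G : SimpleGraph (Option V)) [DecidableRel G.Adj] [MeasurableSpace V] (μ : PMF V) :
    Set (Config V) :=
  {c | Stable G c ∧
    ∀ᵐ ω ∂(Measure.infinitePi fun _ : ℕ => μ.toMeasure), ∃ᶠ k in atTop, chain G c ω k = c}

/-- The level of a configuration: number of grains plus degree of the sink minus number of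
edges. -/
def level (G : SimpleGraph (Option V)) [DecidableRel G.Adj] (c : Config V) : ℤ :=
  (∑ v, (c v : ℤ)) + (G.degree none : ℤ) - (G.edgeFinset.card : ℤ)

end ASM

section Fan

/-- The fan graph `F_n`: the join of the path graph `P_n` and the single vertex `none`, the sink
(vertex `0`). The element `i : Fin n` stands for the vertex `i + 1` of `{1, …, n}`. -/
def fanGraph (n : ℕ) : SimpleGraph (Option (Fin n)) where
  Adj
    | none, none => False
    | none, some _ => True
    | some _, none => True
    | some i, some j => (SimpleGraph.pathGraph n).Adj i j
  symm := ⟨by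
    rintro (_ | i) (_ | j) h
    · exact h
    · trivial
    · trivial
    · exact SimpleGraph.Adj.symm h⟩
  loopless := ⟨by
    rintro (_ | i) h
    · exact h
    · exact SimpleGraph.irrefl _ h⟩

instance (n : ℕ) : DecidableRel (fanGraph n).Adj
  | none, none => isFalse id
  | none, some _ => isTrue trivial
  | some _, none => isTrue trivial
  | some _, some _ => decidable_of_iff _ SimpleGraph.pathGraph_adj.symm

end Fan

section Words

/-- Direction of an edge `{k, k + 1}`: `left` is `k ← k + 1`, `right` is `k → k + 1`. -/
inductive Dir
  | left
  | right
  deriving DecidableEq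

/-- The letters `L^u`, `L^m` and `R`. -/
inductive Letter
  | Lu
  | Lm
  | R
  deriving DecidableEq

/-- Properly marked words of length `m`: no `L^m` is (immediately) followed by an `R`.
The index `i : Fin m` stands for the position `i + 1`. -/
def PMW (m : ℕ) : Type :=
  {w : Fin m → Letter // ∀ i j : Fin m, (i : ℕ) + 1 = (j : ℕ) → w i = Letter.Lm → w j ≠ Letter.R}

/-- The direction of the edge to the right of a vertex carrying `a` grains, from the direction of
the edge to its left. The case of `right` and `a = 0` does not occur for a recurrent
configuration. -/
def nextDir : Dir → ℕ → Dir
  | Dir.left, a => if a = 0 then Dir.right else Dir.left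
  | Dir.right, a => if a = 2 then Dir.left else Dir.right

/-- The orientation of the path `0, 1, …, n`, with `n = m + 1`, that a configuration
`(c_1, …, c_n)` defines (`c i` is `c_{i+1}`): `edgeDir c k` is the direction of `{k, k + 1}`,
for `0 ≤ k ≤ n - 1`. The edge `{0, 1}` is directed leftwards. -/
def edgeDir {m : ℕ} (c : Fin (m + 1) → ℕ) : Fin (m + 1) → Dir :=
  Fin.induction Dir.left fun i d => nextDir d (c i.castSucc)

/-- Whether the vertex `j + 1` is marked: the edge `{j, j + 1}` to its left is directed leftwards,
and the vertex has `2` grains, or `1` grain in the case of the last vertex. -/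
def Marked {m : ℕ} (c : Fin (m + 1) → ℕ) (j : Fin (m + 1)) : Prop :=
  edgeDir c j = Dir.left ∧ c j = if j = Fin.last m then 1 else 2

instance {m : ℕ} (c : Fin (m + 1) → ℕ) (j : Fin (m + 1)) : Decidable (Marked c j) := by
  unfold Marked; infer_instance

/-- The letter of the edge `{i + 1, i + 2}`, where a mark on a vertex is moved to the edge to its
left. -/
def letterAt {m : ℕ} (c : Fin (m + 1) → ℕ) (i : Fin m) : Letter :=
  match edgeDir c i.succ with
  | Dir.right => Letter.R
  | Dir.left => if Marked c i.succ then Letter.Lm else Letter.Lu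

theorem letterAt_proper {m : ℕ} (c : Fin (m + 1) → ℕ) (i j : Fin m) (hij : (i : ℕ) + 1 = (j : ℕ))
    (hi : letterAt c i = Letter.Lm) : letterAt c j ≠ Letter.R := by
  have hs : i.succ = j.castSucc := Fin.ext (by simpa using hij)
  have hM : Marked c i.succ := by
    unfold letterAt at hi
    split at hi
    · simp at hi
    · by_contra h
      simp [h] at hi
  obtain ⟨hd, hc⟩ := hM
  rw [hs] at hd hc
  rw [if_neg (Fin.castSucc_lt_last j).ne] at hc
  have hn : edgeDir c j.succ = Dir.left := by
    have h1 : edgeDir c j.succ = nextDir (edgeDir c j.castSucc) (c j.castSucc) := by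
      simp [edgeDir]
    rw [h1, hd, hc]
    rfl
  unfold letterAt
  rw [hn]
  dsimp only
  split <;> simp

/-- The map `Φ_F` from configurations on `F_n` to properly marked words of length `n - 1`,
where `n = m + 1`. -/
def PhiF {m : ℕ} (c : Config (Fin (m + 1))) : PMW m :=
  ⟨letterAt c, letterAt_proper c⟩

/-- The map `T` from properly marked words of length `n - 1` to subgraphs of the path `P_n`, where
`n = m + 1`: the vertices are `n` and the positions of the letters `L^u` and `L^m`, the edges are
the pairs `{i, i + 1}` such that the `i`-th letter is `L^m`. -/
def T {m : ℕ} (w : PMW m) : (SimpleGraph.pathGraph (m + 1)).Subgraph where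
  verts := {v | (∃ i : Fin m, v = i.castSucc ∧ (w.1 i = Letter.Lu ∨ w.1 i = Letter.Lm)) ∨
    v = Fin.last m}
  Adj u v := ∃ i : Fin m, w.1 i = Letter.Lm ∧
    ((u = i.castSucc ∧ v = i.succ) ∨ (u = i.succ ∧ v = i.castSucc))
  adj_sub := by
    rintro u v ⟨i, -, ⟨rfl, rfl⟩ | ⟨rfl, rfl⟩⟩ <;> simp [SimpleGraph.pathGraph_adj]
  edge_vert := by
    rintro u v ⟨i, hi, ⟨rfl, rfl⟩ | ⟨rfl, rfl⟩⟩
    · exact Or.inl ⟨i, rfl, Or.inr hi⟩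
    · by_cases h : i.succ = Fin.last m
      · exact Or.inr h
      · obtain ⟨j, hj⟩ := Fin.exists_castSucc_eq.mpr h
        have hij : (i : ℕ) + 1 = (j : ℕ) := by
          have := congrArg Fin.val hj
          simpa using this.symm
        refine Or.inl ⟨j, hj.symm, ?_⟩
        have := w.2 i j hij hi
        cases hw : w.1 j <;> simp_all
  symm := ⟨by
    rintro u v ⟨i, hi, h | h⟩
    · exact ⟨i, hi, Or.inr ⟨h.2, h.1⟩⟩
    · exact ⟨i, hi, Or.inl ⟨h.2, h.1⟩⟩⟩

end Words

end Sandpile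

/-! Recurrence is first made combinatorial (`mem_ASMRec_iff`): `c` is recurrent iff it is stable and
has no forbidden subconfiguration. Having none survives added grains and topplings and holds for the
maximal stable configuration, through which the chain passes with positive probability. Conversely,
burning shows that `c` plus any multiple of the all-ones configuration stabilises to `c`, so `c` is
reachable from every stable state, and Borel–Cantelli makes the visits recur.

On the fan, a stable configuration contains a forbidden set iff it contains a block 0, 1, …, 1, 0,
that is, iff some vertex with no grains has a rightward edge on its left
(`noForbidden_fanGraph_iff`). Under this condition the grains at a vertex are determined by its two
edge directions and its mark, so `decode` inverts `PhiF`; `wordOf` inverts `T`. With `d` and `b` the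
indicators of a leftward left edge and of a mark, `c_i = 1 + d_{i+1} - d_i + b_i` (where `d_{n+1} =
0`). Summing telescopes, and the level is the number of marks. -/

namespace Sandpile

/-! ### Finite words in sequences of independent letters -/

section InfiniteProduct

open MeasureTheory ProbabilityTheory Filter

variable {V : Type*}

/-- The sequences in which the periodic pattern `W (n % N)` is matched in the `k`-th block of
length `N`. -/
def blockEvent (W : ℕ → V) (N k : ℕ) : Set (ℕ → V) :=
  Set.pi (Finset.Ico (k * N) ((k + 1) * N)) fun n => {W (n % N)}

theorem mem_blockEvent {W : ℕ → V} {N k : ℕ} {ω : ℕ → V} (h : ω ∈ blockEvent W N k) {i : ℕ}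
    (hi : i < N) : ω (k * N + i) = W i := by
  have := h (k * N + i) (by simp [add_mul]; omega)
  simpa [Nat.mod_eq_of_lt hi] using this

variable [MeasurableSpace V] [MeasurableSingletonClass V]

theorem measurableSet_blockEvent (W : ℕ → V) (N k : ℕ) : MeasurableSet (blockEvent W N k) :=
  MeasurableSet.pi (Finset.countable_toSet _) fun _ _ => measurableSet_singleton _

variable (ν : Measure V) [IsProbabilityMeasure ν]

theorem measure_blockEvent (W : ℕ → V) (N k : ℕ) :
    Measure.infinitePi (fun _ : ℕ => ν) (blockEvent W N k) = ∏ i ∈ Finset.range N, ν {W i} := by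
  rw [blockEvent, Measure.infinitePi_pi _ fun _ _ => measurableSet_singleton _,
    Finset.prod_Ico_eq_prod_range]
  have : (k + 1) * N - k * N = N := by rw [add_mul]; omega
  rw [this]
  refine Finset.prod_congr rfl fun i hi => ?_
  simp [Nat.mod_eq_of_lt (Finset.mem_range.1 hi)]

/-- Distinct blocks involve disjoint sets of coordinates, so an intersection of block events is
again a cylinder and its measure factors. -/
theorem iIndepSet_blockEvent (W : ℕ → V) (N : ℕ) :
    iIndepSet (blockEvent W N) (Measure.infinitePi fun _ : ℕ => ν) := by
  rw [iIndepSet_iff_meas_biInter (measurableSet_blockEvent W N)]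
  intro s
  have hs : ⋂ k ∈ s, blockEvent W N k =
      Set.pi (s.biUnion fun k => Finset.Ico (k * N) ((k + 1) * N) : Finset ℕ)
        fun n => {W (n % N)} := by
    ext ω
    simp only [blockEvent, Set.mem_iInter, Set.mem_pi, Finset.mem_coe, Finset.mem_biUnion]
    exact ⟨fun h n ⟨k, hk, hn⟩ => h k hk n hn, fun h k hk n hn => h n ⟨k, hk, hn⟩⟩
  rw [hs, Measure.infinitePi_pi _ fun _ _ => measurableSet_singleton _, Finset.prod_biUnion]
  · refine Finset.prod_congr rfl fun k _ => ?_
    rw [blockEvent, Measure.infinitePi_pi _ fun _ _ => measurableSet_singleton _]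
  · intro k _ l _ hkl
    refine Finset.disjoint_left.2 fun n hk hl => hkl ?_
    rw [Finset.mem_Ico] at hk hl
    have h1 : k < l + 1 := lt_of_mul_lt_mul_right (hk.1.trans_lt hl.2) (Nat.zero_le N)
    have h2 : l < k + 1 := lt_of_mul_lt_mul_right (hl.1.trans_lt hk.2) (Nat.zero_le N)
    omega

/-- Every finite word almost surely occurs infinitely often in a sequence of independent letters
with a fully supported distribution. -/
theorem ae_frequently_occurs (hν : ∀ v, ν {v} ≠ 0) (l : List V) :
    ∀ᵐ ω ∂(Measure.infinitePi fun _ : ℕ => ν),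
      ∃ᶠ p in atTop, (List.range l.length).map (fun i => ω (p + i)) = l := by
  rcases l with _ | ⟨v, l⟩
  · exact .of_forall fun ω => Frequently.of_forall fun p => rfl
  set N := (v :: l).length with hN
  have hN0 : 0 < N := by simp [hN]
  let W : ℕ → V := fun i => (v :: l).getD i v
  -- Second Borel–Cantelli lemma: all blocks have the same positive probability, so the series of
  -- probabilities diverges.
  have hlim := measure_limsup_eq_one (measurableSet_blockEvent W N) (iIndepSet_blockEvent ν W N)
    (by
      simp_rw [measure_blockEvent]
      exact ENNReal.tsum_const_eq_top_of_ne_zero (Finset.prod_ne_zero_iff.2 fun i _ => hν _))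
  have hae := (mem_ae_iff_prob_eq_one (MeasurableSet.measurableSet_limsup
    (measurableSet_blockEvent W N))).2 hlim
  filter_upwards [hae] with ω hω
  rw [mem_limsup_iff_frequently_mem] at hω
  refine (tendsto_id.atTop_mul_const' hN0).frequently (hω.mono fun k hk => ?_)
  refine List.ext_getElem (by simp [hN]) fun i h1 h2 => ?_
  simp only [List.getElem_map, List.getElem_range, id]
  rw [mem_blockEvent hk h2]
  simp only [W]
  rw [List.getD_eq_getElem _ _ h2]

/-- An almost sure event contains a sequence with any prescribed beginning. -/
theorem exists_prefix_of_ae (hν : ∀ v, ν {v} ≠ 0) (l : List V) {P : (ℕ → V) → Prop}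
    (hP : ∀ᵐ ω ∂(Measure.infinitePi fun _ : ℕ => ν), P ω) :
    ∃ ω, P ω ∧ (List.range l.length).map ω = l := by
  rcases l with _ | ⟨v, l⟩
  · obtain ⟨ω, h⟩ := hP.exists
    exact ⟨ω, h, rfl⟩
  let W : ℕ → V := fun i => (v :: l).getD i v
  have hpos : Measure.infinitePi (fun _ : ℕ => ν) (blockEvent W (v :: l).length 0) ≠ 0 := by
    rw [measure_blockEvent]
    exact Finset.prod_ne_zero_iff.2 fun i _ => hν _
  obtain ⟨ω, hω, h⟩ := ((frequently_ae_mem_iff.2 hpos).and_eventually hP).exists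
  refine ⟨ω, h, List.ext_getElem (by simp) fun i h1 h2 => ?_⟩
  have := mem_blockEvent hω h2
  simp only [W, zero_mul, zero_add] at this
  rw [List.getD_eq_getElem _ _ h2] at this
  simpa using this

end InfiniteProduct

/-! ### Confluence and termination of toppling -/

section Abelian

variable {V : Type*} [Fintype V] [DecidableEq V] {G : SimpleGraph (Option V)}
  [DecidableRel G.Adj]

/-- Both topplings must be legal: only then is the truncated subtraction exact in either order. -/
theorem topple_comm {v w : V} {c : Config V} (hvw : v ≠ w) (hv : G.degree (some v) ≤ c v)
    (hw : G.degree (some w) ≤ c w) : topple G v (topple G w c) = topple G w (topple G v c) := by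
  funext u
  simp only [topple]
  split_ifs <;> subst_vars <;> simp_all <;> omega

theorem le_topple_of_ne {v u : V} {c : Config V} (h : u ≠ v) : c u ≤ topple G v c u := by
  simp [topple, h]

theorem topple_add {v : V} {c : Config V} (hv : G.degree (some v) ≤ c v) (g : Config V) :
    topple G v (c + g) = topple G v c + g := by
  funext u
  simp only [topple, Pi.add_apply]
  split_ifs <;> subst_vars <;> omega

theorem ToppleStep.add {c c' : Config V} (h : ToppleStep G c c') (g : Config V) :
    ToppleStep G (c + g) (c' + g) := by
  obtain ⟨v, hv, rfl⟩ := h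
  exact ⟨v, hv.trans (by simp), (topple_add hv g).symm⟩

/-- Toppling one unstable vertex can only add grains to another, which therefore stays unstable.
This is the local confluence behind uniqueness of the stabilisation. -/
theorem ToppleStep.diamond {a b c : Config V} (hab : ToppleStep G a b) (hac : ToppleStep G a c) :
    ∃ d, Relation.ReflGen (ToppleStep G) b d ∧ Relation.ReflTransGen (ToppleStep G) c d := by
  obtain ⟨v, hv, rfl⟩ := hab
  obtain ⟨w, hw, rfl⟩ := hac
  by_cases hvw : v = w
  · subst hvw
    exact ⟨_, .refl, .refl⟩
  · exact ⟨topple G w (topple G v a),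
      .single ⟨w, hw.trans (le_topple_of_ne (Ne.symm hvw)), rfl⟩,
      .single ⟨v, hv.trans (le_topple_of_ne hvw), (topple_comm hvw hv hw).symm⟩⟩

theorem Stable.not_toppleStep {c c' : Config V} (hc : Stable G c) : ¬ ToppleStep G c c' := by
  rintro ⟨v, hv, -⟩
  exact (hc v).not_ge hv

theorem Stable.eq_of_reflTransGen {c c' : Config V} (hc : Stable G c)
    (h : Relation.ReflTransGen (ToppleStep G) c c') : c' = c := by
  rcases h.cases_head with h | ⟨d, h, -⟩
  · exact h.symm
  · exact (hc.not_toppleStep h).elim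

theorem StabilisesTo.unique {a b c : Config V} (hb : StabilisesTo G a b)
    (hc : StabilisesTo G a c) : b = c := by
  obtain ⟨d, hbd, hcd⟩ := Relation.church_rosser (fun _ _ _ => ToppleStep.diamond) hb.1 hc.1
  rw [← hb.2.eq_of_reflTransGen hbd, ← hc.2.eq_of_reflTransGen hcd]

theorem reflTransGen_toppleStep_add {c c' : Config V}
    (h : Relation.ReflTransGen (ToppleStep G) c c') (g : Config V) :
    Relation.ReflTransGen (ToppleStep G) (c + g) (c' + g) :=
  h.lift (· + g) fun _ _ h => h.add g

theorem StabilisesTo.stabilisation_eq {a b : Config V} (h : StabilisesTo G a b) :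
    stabilisation G a = b := by
  have hex : ∃ c, StabilisesTo G a c := ⟨b, h⟩
  rw [stabilisation, dif_pos hex]
  exact hex.choose_spec.unique h

/-- The sum of the grains decreases when a neighbour of the sink topples. -/
theorem sum_topple_lt (hG : ∀ v, G.Adj (some v) none) {v : V} {c : Config V}
    (hv : G.degree (some v) ≤ c v) : ∑ u, topple G v c u < ∑ u, c u := by
  have hdeg : G.degree (some v) = 1 + ∑ u, if G.Adj (some v) (some u) then 1 else 0 := by
    rw [← SimpleGraph.card_neighborFinset_eq_degree, SimpleGraph.neighborFinset_eq_filter,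
      Finset.card_filter, Fintype.sum_option, if_pos (hG v)]
  have h1 : ∑ u, (if u = v then c u - G.degree (some v) else c u) + G.degree (some v)
      = ∑ u, c u := by
    have : ∑ u, c u = c v + ∑ u ∈ Finset.univ.erase v, c u :=
      (Finset.add_sum_erase _ c (Finset.mem_univ v)).symm
    rw [this, ← Finset.add_sum_erase _ _ (Finset.mem_univ v), if_pos rfl,
      Finset.sum_congr (g := fun u => c u) rfl fun u hu => if_neg (Finset.ne_of_mem_erase hu)]
    omega
  simp only [topple, Finset.sum_add_distrib]
  omega

theorem exists_stabilisesTo (hG : ∀ v, G.Adj (some v) none) (c : Config V) :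
    ∃ c', StabilisesTo G c c' := by
  induction hn : ∑ u, c u using Nat.strong_induction_on generalizing c with
  | _ n ih =>
    by_cases hc : Stable G c
    · exact ⟨c, .refl, hc⟩
    · simp only [Stable, not_forall, not_lt] at hc
      obtain ⟨v, hv⟩ := hc
      obtain ⟨c', h1, h2⟩ := ih _ (hn ▸ sum_topple_lt hG hv) (topple G v c) rfl
      exact ⟨c', .head ⟨v, hv, rfl⟩ h1, h2⟩

theorem stabilisesTo_stabilisation (hG : ∀ v, G.Adj (some v) none) (c : Config V) :
    StabilisesTo G c (stabilisation G c) := by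
  obtain ⟨c', h⟩ := exists_stabilisesTo hG c
  rwa [h.stabilisation_eq]

end Abelian

/-! ### Reachability by words of grains -/

section Words

variable {V : Type*} [Fintype V] [DecidableEq V] {G : SimpleGraph (Option V)}
  [DecidableRel G.Adj]

variable (G) in
/-- The state that the sandpile chain reaches from `c` when the grains fall on the vertices of a
list. -/
noncomputable def run (c : Config V) (l : List V) : Config V :=
  l.foldl (fun d v => stabilisation G (d + Pi.single v 1)) c

theorem run_append (c : Config V) (l l' : List V) : run G c (l ++ l') = run G (run G c l) l' :=
  List.foldl_append

theorem chain_add (c : Config V) (ω : ℕ → V) (p k : ℕ) :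
    chain G c ω (p + k) = run G (chain G c ω p) ((List.range k).map fun i => ω (p + i)) := by
  induction k with
  | zero => rfl
  | succ k ih =>
    rw [List.range_succ, List.map_append, run_append, ← ih]
    rfl

theorem chain_eq_run (c : Config V) (ω : ℕ → V) (k : ℕ) :
    chain G c ω k = run G c ((List.range k).map ω) := by
  simpa [chain] using chain_add (G := G) c ω 0 k

/-- The Abelian property: stabilising after every grain gives the same result as adding all grains
and stabilising once. -/
theorem stabilisesTo_run (hG : ∀ v, G.Adj (some v) none) {c : Config V}
    (hc : Stable G c) (l : List V) :
    StabilisesTo G (c + (l.map fun v => (Pi.single v 1 : Config V)).sum) (run G c l) := by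
  induction l using List.reverseRecOn with
  | nil => exact ⟨by simpa [run] using .refl, hc⟩
  | append_singleton l v ih =>
    have h := stabilisesTo_stabilisation hG (run G c l + Pi.single v 1)
    rw [run_append]
    refine ⟨.trans ?_ h.1, h.2⟩
    simpa [add_assoc] using reflTransGen_toppleStep_add ih.1 (Pi.single v 1)

theorem Stable.chain (hG : ∀ v, G.Adj (some v) none) {c : Config V}
    (hc : Stable G c) (ω : ℕ → V) (k : ℕ) :
    Stable G (chain G c ω k) := by
  rw [chain_eq_run]
  exact (stabilisesTo_run hG hc _).2

theorem exists_list_sum_single (g : Config V) :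
    ∃ l : List V, (l.map fun v => (Pi.single v 1 : Config V)).sum = g := by
  suffices H : ∀ s : Finset V, ∃ l : List V,
      (l.map fun v => (Pi.single v 1 : Config V)).sum = ∑ v ∈ s, g v • Pi.single v 1 by
    obtain ⟨l, hl⟩ := H Finset.univ
    refine ⟨l, hl.trans (funext fun u => ?_)⟩
    simp [Finset.sum_apply, Pi.single_apply]
  intro s
  induction s using Finset.induction_on with
  | empty => exact ⟨[], by simp⟩
  | insert v s hv ih =>
    obtain ⟨l, hl⟩ := ih
    exact ⟨List.replicate (g v) v ++ l, by simp [hl, Finset.sum_insert hv]⟩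

/-- A stable configuration is reached from `c` when a suitable word of grains is added if it is
the stabilisation of a configuration above `c`. -/
theorem exists_run_eq (hG : ∀ v, G.Adj (some v) none) {c d e : Config V}
    (hc : Stable G c) (hce : c ≤ e) (h : StabilisesTo G e d) : ∃ l, run G c l = d := by
  obtain ⟨l, hl⟩ := exists_list_sum_single (e - c)
  refine ⟨l, (stabilisesTo_run hG hc l).unique ?_⟩
  rwa [hl, add_tsub_cancel_of_le hce]

/-- If `c` is reachable from all stable configurations, then some word leads every stable
configuration through `c`. -/
theorem exists_universal_list (hG : ∀ v, G.Adj (some v) none) {c : Config V}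
    (h : ∀ d, Stable G d → ∃ l, run G d l = c) :
    ∃ l : List V, ∀ d, Stable G d → ∃ k ≤ l.length, run G d (l.take k) = c := by
  have hfin : {d : Config V | Stable G d}.Finite :=
    (Set.finite_Iic (fun v => G.degree (some v))).subset fun d hd v => (hd v).le
  suffices H : ∀ s : Finset (Config V), (∀ d ∈ s, Stable G d) →
      ∃ l : List V, ∀ d ∈ s, ∃ k ≤ l.length, run G d (l.take k) = c by
    obtain ⟨l, hl⟩ := H hfin.toFinset fun d hd => hfin.mem_toFinset.1 hd
    exact ⟨l, fun d hd => hl d (hfin.mem_toFinset.2 hd)⟩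
  intro s
  induction s using Finset.induction_on with
  | empty => exact fun _ => ⟨[], by simp⟩
  | insert a s _ ih =>
    intro hs
    obtain ⟨l, hl⟩ := ih fun d hd => hs d (Finset.mem_insert_of_mem hd)
    -- The word is extended so that the new state `a`, after following `l`, ends at `c`; the other
    -- states already met `c` along a prefix of `l`.
    obtain ⟨l', hl'⟩ := h _ (stabilisesTo_run hG (hs a (Finset.mem_insert_self a s)) l).2
    refine ⟨l ++ l', fun d hd => ?_⟩
    rcases Finset.mem_insert.1 hd with rfl | hd
    · exact ⟨_, le_rfl, by rw [List.take_length, run_append, hl']⟩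
    · obtain ⟨k, hk, hr⟩ := hl d hd
      exact ⟨k, hk.trans (by simp), by rwa [List.take_append_of_le_length hk]⟩

end Words

/-! ### Forbidden subconfigurations and the burning algorithm -/

section Dhar

variable {V : Type*} {G : SimpleGraph (Option V)} [DecidableRel G.Adj]

variable (G) in
/-- The number of neighbours of `v` in the set `A` of non-sink vertices. -/
def degIn (A : Finset V) (v : V) : ℕ := (A.filter fun u => G.Adj (some v) (some u)).card

variable (G) in
/-- Dhar's criterion: the configuration has no forbidden subconfiguration, which is a nonempty set
of vertices each of which has fewer grains than neighbours in the set. -/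
def NoForbidden (c : Config V) : Prop :=
  ∀ A : Finset V, A.Nonempty → ∃ v ∈ A, degIn G A v ≤ c v

/-- The neighbour that `v` loses when `u` leaves the set matches the grain that `v` gains when `u`
topples. -/
theorem degIn_erase_add [DecidableEq V] (A : Finset V) (u v : V) (hu : u ∈ A) :
    degIn G (A.erase u) v + (if G.Adj (some u) (some v) then 1 else 0) = degIn G A v := by
  rw [if_congr (G.adj_comm (some u) (some v)) rfl rfl]
  unfold degIn
  rw [Finset.filter_erase]
  split_ifs with h
  · exact Finset.card_erase_add_one (by simp [hu, h])
  · rw [Finset.erase_eq_of_notMem (by simp [h]), add_zero]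

theorem NoForbidden.mono {c d : Config V} (hc : NoForbidden G c) (h : c ≤ d) :
    NoForbidden G d := fun A hA => by
  obtain ⟨v, hv, hle⟩ := hc A hA
  exact ⟨v, hv, hle.trans (h v)⟩

theorem degree_eq_one_add_degIn [Fintype V] (hG : ∀ v, G.Adj (some v) none) (v : V) :
    G.degree (some v) = 1 + degIn G Finset.univ v := by
  rw [← SimpleGraph.card_neighborFinset_eq_degree, SimpleGraph.neighborFinset_eq_filter,
    Finset.card_filter, Fintype.sum_option, if_pos (hG v), degIn, Finset.card_filter]

variable [Fintype V] [DecidableEq V]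

/-- If `u ∈ A`, a good vertex of `A.erase u` stays good for `A`, as it gains a grain exactly when it
gains the neighbour `u`. If `u ∉ A`, no vertex of `A` loses grains. -/
theorem NoForbidden.topple {c : Config V} (hc : NoForbidden G c) (u : V) :
    NoForbidden G (topple G u c) := by
  intro A hA
  by_cases hu : u ∈ A
  · rcases (A.erase u).eq_empty_or_nonempty with hE | hE
    · refine ⟨u, hu, ?_⟩
      have h := degIn_erase_add (G := G) A u u hu
      simp [hE, degIn] at h
      simp [degIn, ← h]
    · obtain ⟨v, hv, hle⟩ := hc _ hE
      refine ⟨v, Finset.mem_of_mem_erase hv, ?_⟩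
      rw [← degIn_erase_add A u v hu]
      simp only [Sandpile.topple, if_neg (Finset.ne_of_mem_erase hv)]
      omega
  · obtain ⟨v, hv, hle⟩ := hc A hA
    exact ⟨v, hv, hle.trans (le_topple_of_ne fun h => hu (h ▸ hv))⟩

theorem NoForbidden.reflTransGen {c d : Config V} (hc : NoForbidden G c)
    (h : Relation.ReflTransGen (ToppleStep G) c d) : NoForbidden G d := by
  induction h with
  | refl => exact hc
  | tail _ h ih =>
    obtain ⟨v, -, rfl⟩ := h
    exact ih.topple v

/-- The burning algorithm: adding one grain at each vertex, the vertices topple once each. -/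
theorem NoForbidden.reflTransGen_add_one (hG : ∀ v, G.Adj (some v) none) {c : Config V}
    (hc : NoForbidden G c) :
    Relation.ReflTransGen (ToppleStep G) (c + 1) c := by
  -- `A` is the set of vertices still to topple. Each vertex has received a grain from the sink and
  -- one from each neighbour outside `A`; those outside `A` have also lost their degree.
  suffices H : ∀ (A : Finset V) (d : Config V),
      (∀ v ∈ A, d v + degIn G A v = c v + G.degree (some v)) →
      (∀ v ∉ A, d v + degIn G A v = c v) → Relation.ReflTransGen (ToppleStep G) d c from
    H Finset.univ _ (fun v _ => by
      rw [degree_eq_one_add_degIn hG, Pi.add_apply, Pi.one_apply, add_assoc]) (by simp)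
  intro A
  induction A using Finset.strongInduction with
  | H A ih =>
    intro d h1 h2
    rcases A.eq_empty_or_nonempty with rfl | hA
    · have : d = c := funext fun v => by simpa [degIn] using h2 v (by simp)
      exact this ▸ .refl
    obtain ⟨v, hv, hle⟩ := hc A hA
    have hdv := h1 v hv
    refine .head ⟨v, by omega, rfl⟩
      (ih _ (Finset.erase_ssubset hv) _ (fun u hu => ?_) fun u hu => ?_)
    · have := h1 u (Finset.mem_of_mem_erase hu)
      rw [← degIn_erase_add A v u hv] at this
      simp only [Sandpile.topple, if_neg (Finset.ne_of_mem_erase hu)]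
      omega
    · by_cases huv : u = v
      · subst huv
        rw [← degIn_erase_add A u u hv] at hdv hle
        simp only [Sandpile.topple, SimpleGraph.irrefl, if_true, if_false] at hdv hle ⊢
        omega
      · have := h2 u fun h => hu (Finset.mem_erase.2 ⟨huv, h⟩)
        rw [← degIn_erase_add A v u hv] at this
        simp only [Sandpile.topple, if_neg huv]
        omega

theorem NoForbidden.reflTransGen_add_nsmul_one (hG : ∀ v, G.Adj (some v) none) {c : Config V}
    (hc : NoForbidden G c) (k : ℕ) : Relation.ReflTransGen (ToppleStep G) (c + k • 1) c := by
  induction k with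
  | zero => simpa using .refl
  | succ k ih =>
    rw [succ_nsmul', ← add_assoc]
    exact (reflTransGen_toppleStep_add (hc.reflTransGen_add_one hG) _).trans ih

/-- On a graph whose sink is adjacent to all other vertices, the recurrent configurations are the
stable ones without forbidden subconfiguration. -/
theorem mem_ASMRec_iff (hG : ∀ v, G.Adj (some v) none) [MeasurableSpace V]
    [MeasurableSingletonClass V] (μ : PMF V) (hμ : ∀ v, 0 < μ v) {c : Config V} :
    c ∈ ASMRec G μ ↔ Stable G c ∧ NoForbidden G c := by
  have hν : ∀ v, μ.toMeasure {v} ≠ 0 := fun v => by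
    rw [μ.toMeasure_apply_singleton v (measurableSet_singleton v)]
    exact (hμ v).ne'
  refine and_congr_right fun hc => ⟨fun h => ?_, fun h => ?_⟩
  -- `M` is the maximal stable configuration. Some word leads from `c` to `M`; it is a prefix of a
  -- trajectory that returns to `c`, so `c` is reachable from `M`.
  · let M : Config V := fun v => G.degree (some v) - 1
    have hdeg := degree_eq_one_add_degIn hG
    have hM : Stable G M := fun v => by
      have := hdeg v
      simp only [M]
      omega
    obtain ⟨l, hl⟩ := exists_run_eq hG hc
      (fun v => Nat.le_sub_one_of_lt (hc v) : c ≤ M) ⟨.refl, hM⟩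
    obtain ⟨ω, hω, hlω⟩ := exists_prefix_of_ae _ hν l h
    obtain ⟨k, hk, hkc⟩ := Filter.frequently_atTop.1 hω l.length
    obtain ⟨j, rfl⟩ := Nat.exists_eq_add_of_le hk
    rw [chain_add, chain_eq_run c ω, hlω, hl] at hkc
    rw [← hkc]
    refine NoForbidden.reflTransGen ?_ (stabilisesTo_run hG hM _).1
    refine NoForbidden.mono (c := M) (fun A hA => ?_) (by simp)
    obtain ⟨v, hv⟩ := hA
    refine ⟨v, hv, ?_⟩
    simp only [M, hdeg, Nat.add_sub_cancel_left]
    exact Finset.card_le_card (Finset.filter_subset_filter _ (Finset.subset_univ _))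
  · obtain ⟨l, hl⟩ := exists_universal_list hG (c := c) fun d hd =>
      -- Degrees are below `Fintype.card (Option V)`, so this many grains at each vertex dominate
      -- every stable configuration.
      exists_run_eq hG (e := c + Fintype.card (Option V) • 1) hd
        (fun v => by
          have := (hd v).trans (G.degree_lt_card_verts (some v))
          simp only [Pi.add_apply, Pi.smul_apply, Pi.one_apply, smul_eq_mul, mul_one]
          omega)
        ⟨h.reflTransGen_add_nsmul_one hG _, hc⟩
    filter_upwards [ae_frequently_occurs μ.toMeasure hν l] with ω hω
    refine Filter.frequently_atTop.2 fun a => ?_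
    obtain ⟨p, hp, hpl⟩ := Filter.frequently_atTop.1 hω a
    obtain ⟨k, hk, hkc⟩ := hl _ (hc.chain hG ω p)
    refine ⟨p + k, by omega, ?_⟩
    rw [chain_add]
    refine Eq.trans ?_ hkc
    rw [← hpl, ← List.map_take, List.take_range, min_eq_left hk]

end Dhar

/-! ### Recurrent configurations of the fan -/

section FanRecurrent

theorem fanGraph_adj_none {n : ℕ} (v : Fin n) : (fanGraph n).Adj (some v) none := trivial

theorem fanGraph_adj_some {n : ℕ} {u v : Fin n} :
    (fanGraph n).Adj (some u) (some v) ↔ (u : ℕ) + 1 = v ∨ (v : ℕ) + 1 = u :=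
  SimpleGraph.pathGraph_adj

/-- A vertex of the path has at most one neighbour on each side, so each count is an indicator. -/
theorem degIn_fanGraph {n : ℕ} (A : Finset (Fin n)) (i : Fin n) :
    degIn (fanGraph n) A i = (if ∃ u ∈ A, (i : ℕ) + 1 = u then 1 else 0) +
      (if ∃ u ∈ A, (u : ℕ) + 1 = i then 1 else 0) := by
  have key : ∀ p : Fin n → Prop, [DecidablePred p] → (∀ u v, p u → p v → u = v) →
      (A.filter p).card = if ∃ u ∈ A, p u then 1 else 0 := by
    intro p _ hp
    split_ifs with h
    · obtain ⟨u, hu, hpu⟩ := h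
      refine Finset.card_eq_one.2 ⟨u, Finset.ext fun v => ?_⟩
      rw [Finset.mem_filter, Finset.mem_singleton]
      exact ⟨fun hv => hp _ _ hv.2 hpu, fun hv => hv ▸ ⟨hu, hpu⟩⟩
    · exact Finset.card_eq_zero.2 (Finset.filter_eq_empty_iff.2 fun u hu hpu => h ⟨u, hu, hpu⟩)
  rw [← key (fun u => (i : ℕ) + 1 = u) (fun u v _ _ => by omega),
    ← key (fun u => (u : ℕ) + 1 = i) (fun u v _ _ => by omega), degIn,
    ← Finset.card_union_of_disjoint, ← Finset.filter_or]
  · congr 1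
    exact Finset.filter_congr fun u _ => fanGraph_adj_some
  · exact Finset.disjoint_filter.2 fun u _ _ => by omega

theorem degree_fanGraph {m : ℕ} (i : Fin (m + 1)) : (fanGraph (m + 1)).degree (some i) =
    1 + (if i = Fin.last m then 0 else 1) + (if i = 0 then 0 else 1) := by
  rw [degree_eq_one_add_degIn fanGraph_adj_none, degIn_fanGraph, add_assoc]
  have h1 : (∃ u ∈ (Finset.univ : Finset (Fin (m + 1))), (i : ℕ) + 1 = u) ↔ i ≠ Fin.last m := by
    rw [Ne, Fin.ext_iff, Fin.val_last]
    exact ⟨fun ⟨u, _, hu⟩ => by omega, fun h => ⟨⟨i + 1, by omega⟩, by simp, rfl⟩⟩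
  have h2 : (∃ u ∈ (Finset.univ : Finset (Fin (m + 1))), (u : ℕ) + 1 = i) ↔ i ≠ 0 := by
    rw [Ne, Fin.ext_iff, Fin.val_zero]
    refine ⟨fun ⟨u, _, hu⟩ => by omega, fun h => ⟨⟨i - 1, by omega⟩, by simp, ?_⟩⟩
    show (i : ℕ) - 1 + 1 = i
    omega
  rw [if_congr h1 rfl rfl, if_congr h2 rfl rfl, ite_not, ite_not]

theorem edgeDir_succ {m : ℕ} (c : Fin (m + 1) → ℕ) (i : Fin m) :
    edgeDir c i.succ = nextDir (edgeDir c i.castSucc) (c i.castSucc) := by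
  simp [edgeDir]

theorem edgeDir_zero {m : ℕ} (c : Fin (m + 1) → ℕ) : edgeDir c 0 = Dir.left := rfl

/-- The vertex `a` is where the current run of rightward edges starts; a 2 inside the run would have
ended it. -/
theorem exists_zero_of_edgeDir_eq_right {m : ℕ} (c : Fin (m + 1) → ℕ) (i : Fin (m + 1))
    (h : edgeDir c i = Dir.right) : ∃ a < i, c a = 0 ∧ ∀ j, a < j → j < i → c j ≠ 2 := by
  induction i using Fin.induction with
  | zero => simp [edgeDir_zero] at h
  | succ i ih =>
    rw [edgeDir_succ] at h
    rcases hd : edgeDir c i.castSucc with _ | _ <;> rw [hd] at h <;> simp only [nextDir] at h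
    · refine ⟨i.castSucc, Fin.castSucc_lt_succ, by by_contra h0; simp [h0] at h,
        fun j h1 h2 => ?_⟩
      simp only [Fin.lt_def, Fin.val_castSucc, Fin.val_succ] at h1 h2
      omega
    · obtain ⟨a, ha, h0, h2⟩ := ih hd
      refine ⟨a, ha.trans Fin.castSucc_lt_succ, h0, fun j h3 h4 => ?_⟩
      rcases (Fin.le_castSucc_iff.2 h4).lt_or_eq with h5 | rfl
      · exact h2 j h3 h5
      · intro h5
        simp [h5] at h

theorem noForbidden_fanGraph_iff {m : ℕ} {c : Config (Fin (m + 1))}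
    (hc : Stable (fanGraph (m + 1)) c) :
    NoForbidden (fanGraph (m + 1)) c ↔ ∀ i, edgeDir c i = Dir.right → c i ≠ 0 := by
  constructor
  · intro h i hi hi0
    obtain ⟨a, hai, ha0, ha2⟩ := exists_zero_of_edgeDir_eq_right c i hi
    -- This interval is forbidden: its ends have no grains and one neighbour inside, its inner
    -- vertices at most one grain and two neighbours inside.
    obtain ⟨v, hv, hle⟩ := h (Finset.Icc a i) ⟨a, by simp [hai.le]⟩
    rw [Finset.mem_Icc] at hv
    rw [degIn_fanGraph] at hle
    have hup : v < i → ∃ u ∈ Finset.Icc a i, (v : ℕ) + 1 = u := fun hvi =>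
      ⟨⟨v + 1, by omega⟩, Finset.mem_Icc.2 ⟨hv.1.trans (Nat.le_succ v), hvi⟩, rfl⟩
    have hdown : a < v → ∃ u ∈ Finset.Icc a i, (u : ℕ) + 1 = v := fun hav =>
      ⟨⟨v - 1, by omega⟩, Finset.mem_Icc.2 ⟨Nat.le_sub_one_of_lt hav,
        (Nat.sub_le v 1).trans hv.2⟩, Nat.succ_pred_eq_of_pos (Nat.zero_lt_of_lt hav)⟩
    rcases hv.1.lt_or_eq with hav | rfl
    · rw [if_pos (hdown hav)] at hle
      rcases hv.2.lt_or_eq with hvi | rfl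
      · rw [if_pos (hup hvi)] at hle
        have h2 := ha2 v hav hvi
        have h3 := hc v
        rw [degree_fanGraph] at h3
        split_ifs at h3 <;> omega
      · omega
    · rw [if_pos (hup hai)] at hle
      omega
  · intro h A hA
    by_contra! hcon
    simp_rw [degIn_fanGraph] at hcon
    set a := A.min' hA with ha
    have haA : a ∈ A := A.min'_mem hA
    have hmin : ∀ u ∈ A, a ≤ u := fun u hu => A.min'_le u hu
    -- The minimum `a` of a forbidden set has no grains, so the run turns rightwards and `a + 1`
    -- lies in `A`. A later vertex with a rightward edge on its left is nonzero, hence has one grain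
    -- and needs both neighbours in `A`. This propagates to the last vertex, which has no right
    -- neighbour.
    have key : ∀ j : Fin (m + 1), a < j → j ∈ A ∧ edgeDir c j = Dir.right := by
      intro j
      induction j using Fin.induction with
      | zero => exact fun h => absurd h (Fin.not_lt_zero _)
      | succ j ih =>
        intro haj
        have hup : (∃ u ∈ A, (j.castSucc : ℕ) + 1 = u) → j.succ ∈ A := by
          rintro ⟨u, hu, hju⟩
          have : j.succ = u := Fin.ext (by simpa using hju)
          rwa [this]
        rw [edgeDir_succ]
        rcases (Fin.le_castSucc_iff.2 haj).lt_or_eq with h1 | h1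
        · obtain ⟨h2, h3⟩ := ih h1
          have h4 := h _ h3
          have h5 := hcon _ h2
          have h6 : c j.castSucc = 1 := by split_ifs at h5 <;> omega
          refine ⟨hup ?_, by simp [h3, h6, nextDir]⟩
          by_contra h7
          rw [if_neg h7] at h5
          split_ifs at h5 <;> omega
        · have h5 := hcon _ haA
          rw [h1] at h5
          rw [if_neg (c := ∃ u ∈ A, (u : ℕ) + 1 = (j.castSucc : ℕ)) (by
            rintro ⟨u, hu, hju⟩
            have := hmin u hu
            rw [h1, Fin.le_def] at this
            omega)] at h5
          have h6 : c j.castSucc = 0 := by split_ifs at h5 <;> omega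
          refine ⟨hup ?_, ?_⟩
          · by_contra h7
            rw [if_neg h7] at h5
            omega
          · rcases hd : edgeDir c j.castSucc with _ | _
            · simp [nextDir, h6]
            · exact absurd h6 (h _ hd)
    have hlast := fun h => hcon (Fin.last m) h
    have hnot : ¬ ∃ u ∈ A, (Fin.last m : ℕ) + 1 = u := by
      rintro ⟨u, -, hu⟩
      have := u.2
      simp only [Fin.val_last] at hu
      omega
    rcases (Fin.le_last a).lt_or_eq with h1 | h1
    · obtain ⟨h2, h3⟩ := key _ h1
      have h4 := h _ h3
      have h5 := hcon _ h2
      rw [if_neg hnot] at h5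
      split_ifs at h5 <;> omega
    · have h5 := hcon _ haA
      rw [h1, if_neg hnot, if_neg (by
        rintro ⟨u, hu, hju⟩
        have := hmin u hu
        rw [h1, Fin.le_def] at this
        omega)] at h5
      omega

theorem mem_ASMRec_fanGraph_iff {m : ℕ} (μ : PMF (Fin (m + 1))) (hμ : ∀ i, 0 < μ i)
    {c : Config (Fin (m + 1))} : c ∈ ASMRec (fanGraph (m + 1)) μ ↔
      (∀ i, c i < 1 + (if i = Fin.last m then 0 else 1) + (if i = 0 then 0 else 1)) ∧
        ∀ i, edgeDir c i = Dir.right → c i ≠ 0 := by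
  rw [mem_ASMRec_iff fanGraph_adj_none μ hμ]
  simp_rw [← degree_fanGraph]
  exact and_congr_right fun h => noForbidden_fanGraph_iff h

theorem degree_none_fanGraph (m : ℕ) : (fanGraph (m + 1)).degree none = m + 1 := by
  rw [← SimpleGraph.card_neighborFinset_eq_degree, SimpleGraph.neighborFinset_eq_filter,
    Finset.card_filter, Fintype.sum_option]
  have h (i : Fin (m + 1)) : (fanGraph (m + 1)).Adj none (some i) := trivial
  simp [h]

theorem card_edgeFinset_fanGraph (m : ℕ) : (fanGraph (m + 1)).edgeFinset.card = 2 * m + 1 := by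
  have h := (fanGraph (m + 1)).sum_degrees_eq_twice_card_edges
  rw [Fintype.sum_option, degree_none_fanGraph] at h
  simp_rw [degree_fanGraph, Finset.sum_add_distrib] at h
  rw [Fin.sum_univ_castSucc (fun i => if i = Fin.last m then 0 else 1),
    Fin.sum_univ_succ (fun i => if i = 0 then 0 else 1)] at h
  simp [Fin.castSucc_ne_last] at h
  omega

end FanRecurrent

/-! ### Configurations, words and subgraphs -/

section Bijection

variable {m : ℕ}

/-- The recurrent configurations of the fan graph, described by the orientation of the path. -/
def FanRecurrent (c : Config (Fin (m + 1))) : Prop :=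
  (∀ i, c i < 1 + (if i = Fin.last m then 0 else 1) + (if i = 0 then 0 else 1)) ∧
    ∀ i, edgeDir c i = Dir.right → c i ≠ 0

/-- No letter stands for the edge `{0, 1}`, so a mark on the first vertex would be lost; its degree
is too small for one. -/
theorem FanRecurrent.not_marked_zero {c : Config (Fin (m + 1))} (hc : FanRecurrent c) :
    ¬ Marked c 0 := by
  rintro ⟨-, h⟩
  have h0 := hc.1 0
  rw [if_pos rfl] at h0
  split_ifs at h h0 <;> omega

theorem letterAt_eq_R_iff (c : Fin (m + 1) → ℕ) (i : Fin m) :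
    letterAt c i = Letter.R ↔ edgeDir c i.succ = Dir.right := by
  unfold letterAt
  cases edgeDir c i.succ
  · dsimp only
    split_ifs <;> simp
  · simp

theorem letterAt_eq_Lm_iff (c : Fin (m + 1) → ℕ) (i : Fin m) :
    letterAt c i = Letter.Lm ↔ Marked c i.succ := by
  unfold letterAt
  rcases h : edgeDir c i.succ with _ | _
  · simp
  · simp [Marked, h]

/-- The orientation of the path that is read from a word. -/
def dirOf (w : Fin m → Letter) : Fin (m + 1) → Dir :=
  Fin.cases Dir.left fun i => if w i = Letter.R then Dir.right else Dir.left

/-- Whether a word marks a vertex of the path. -/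
def markOf (w : Fin m → Letter) : Fin (m + 1) → Bool :=
  Fin.cases false fun i => decide (w i = Letter.Lm)

/-- The number of grains of a vertex other than the last one, from the directions of the edges to
its left and to its right and its mark. -/
def innerGrains : Dir → Dir → Bool → ℕ
  | Dir.left, Dir.right, _ => 0
  | Dir.right, Dir.left, _ => 2
  | Dir.right, Dir.right, _ => 1
  | Dir.left, Dir.left, b => if b then 2 else 1

/-- The number of grains of the last vertex, from the direction of the edge to its left and its
mark. -/
def lastGrains : Dir → Bool → ℕ
  | Dir.right, _ => 1
  | Dir.left, b => if b then 1 else 0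

/-- The recurrent configuration that is encoded by a word. -/
def decode (w : Fin m → Letter) : Config (Fin (m + 1)) :=
  Fin.lastCases (lastGrains (dirOf w (Fin.last m)) (markOf w (Fin.last m))) fun i =>
    innerGrains (dirOf w i.castSucc) (dirOf w i.succ) (markOf w i.castSucc)

theorem decode_last (w : Fin m → Letter) :
    decode w (Fin.last m) = lastGrains (dirOf w (Fin.last m)) (markOf w (Fin.last m)) := by
  simp [decode]

theorem decode_castSucc (w : Fin m → Letter) (i : Fin m) : decode w i.castSucc =
    innerGrains (dirOf w i.castSucc) (dirOf w i.succ) (markOf w i.castSucc) := by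
  simp [decode]

theorem dirOf_letterAt (c : Fin (m + 1) → ℕ) : dirOf (letterAt c) = edgeDir c := by
  funext k
  cases k using Fin.cases with
  | zero => rfl
  | succ i =>
    simp only [dirOf, Fin.cases_succ, letterAt_eq_R_iff]
    cases edgeDir c i.succ <;> simp

theorem FanRecurrent.markOf_letterAt {c : Config (Fin (m + 1))} (hc : FanRecurrent c)
    (k : Fin (m + 1)) : markOf (letterAt c) k = decide (Marked c k) := by
  cases k using Fin.cases with
  | zero => simp [markOf, hc.not_marked_zero]
  | succ i => simp [markOf, letterAt_eq_Lm_iff]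

/-- Only two ambiguities arise: after a right-right pair recurrence excludes 0, and for a left-left
pair the mark separates 1 from 2. -/
theorem FanRecurrent.decode_letterAt {c : Config (Fin (m + 1))} (hc : FanRecurrent c) :
    decode (letterAt c) = c := by
  funext k
  have h1 := hc.1 k
  have h2 := hc.2 k
  cases k using Fin.lastCases with
  | last =>
    rw [decode_last, dirOf_letterAt, hc.markOf_letterAt]
    rcases hd : edgeDir c (Fin.last m) with _ | _
    · simp only [lastGrains, Marked, hd]
      simp at h1 ⊢
      split_ifs at h1 ⊢ <;> omega
    · have := h2 hd
      simp only [lastGrains]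
      simp at h1
      split_ifs at h1 <;> omega
  | cast i =>
    rw [decode_castSucc, dirOf_letterAt, hc.markOf_letterAt, edgeDir_succ]
    have h3 : c i.castSucc < 3 := by split_ifs at h1 <;> omega
    rcases hd : edgeDir c i.castSucc with _ | _
    · interval_cases hci : c i.castSucc <;> simp [nextDir, innerGrains, Marked, hd, hci]
    · have := h2 hd
      interval_cases hci : c i.castSucc <;> simp_all [nextDir, innerGrains]

theorem edgeDir_decode (w : Fin m → Letter) : edgeDir (decode w) = dirOf w := by
  funext k
  induction k using Fin.induction with
  | zero => rfl
  | succ i ih =>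
    rw [edgeDir_succ, ih, decode_castSucc]
    cases dirOf w i.castSucc <;> cases dirOf w i.succ <;> cases markOf w i.castSucc <;>
      simp [nextDir, innerGrains]

/-- Properness of the word is essential here: a left-right vertex gets no grains whatever its mark,
so an `Lm` followed by `R` would lose its mark. -/
theorem marked_decode_iff (w : PMW m) (k : Fin (m + 1)) :
    Marked (decode w.1) k ↔ markOf w.1 k = true := by
  have hdir : markOf w.1 k = true → dirOf w.1 k = Dir.left := by
    cases k using Fin.cases with
    | zero => simp [markOf]
    | succ i => simp +contextual [markOf, dirOf]
  rw [Marked, edgeDir_decode]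
  cases k using Fin.lastCases with
  | last =>
    rw [decode_last]
    cases hm : markOf w.1 (Fin.last m) <;> cases hd : dirOf w.1 (Fin.last m) <;>
      simp_all [lastGrains]
  | cast i =>
    have hnext : markOf w.1 i.castSucc = true → dirOf w.1 i.succ = Dir.left := by
      simp only [dirOf, Fin.cases_succ]
      intro h
      rcases i.castSucc.eq_zero_or_eq_succ with h0 | ⟨j, hj⟩
      · rw [h0] at h
        simp [markOf] at h
      · rw [hj] at h
        have hji : (j : ℕ) + 1 = i := by simpa using (congrArg Fin.val hj).symm
        rw [if_neg (w.2 j i hji (by simpa [markOf] using h))]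
    rw [decode_castSucc, if_neg (Fin.castSucc_ne_last i)]
    cases hm : markOf w.1 i.castSucc <;> cases hd : dirOf w.1 i.castSucc <;>
      cases hd' : dirOf w.1 i.succ <;> simp_all [innerGrains]

theorem fanRecurrent_decode (w : Fin m → Letter) : FanRecurrent (decode w) := by
  refine ⟨fun k => ?_, fun k => ?_⟩
  · cases k using Fin.lastCases with
    | last =>
      rw [decode_last, if_pos rfl]
      split_ifs with h
      · rw [h]
        simp [dirOf, markOf, lastGrains]
      · cases dirOf w (Fin.last m) <;> cases markOf w (Fin.last m) <;> simp [lastGrains]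
    | cast i =>
      rw [decode_castSucc, if_neg (Fin.castSucc_ne_last i)]
      split_ifs with h
      · rw [h]
        cases dirOf w i.succ <;> simp [dirOf, markOf, innerGrains]
      · cases dirOf w i.castSucc <;> cases dirOf w i.succ <;> cases markOf w i.castSucc <;>
          simp [innerGrains]
  · rw [edgeDir_decode]
    intro hd
    cases k using Fin.lastCases with
    | last => simp [decode_last, hd, lastGrains]
    | cast i =>
      rw [decode_castSucc, hd]
      cases dirOf w i.succ <;> simp [innerGrains]

theorem PhiF_decode (w : PMW m) : PhiF (decode w.1) = w := by
  refine Subtype.ext (funext fun i => ?_)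
  have hR := letterAt_eq_R_iff (decode w.1) i
  have hM := letterAt_eq_Lm_iff (decode w.1) i
  rw [edgeDir_decode] at hR
  rw [marked_decode_iff] at hM
  simp only [dirOf, markOf, Fin.cases_succ] at hR hM
  show letterAt (decode w.1) i = w.1 i
  cases h : w.1 i <;> cases h' : letterAt (decode w.1) i <;> simp_all

theorem bijOn_PhiF : Set.BijOn (PhiF (m := m)) {c | FanRecurrent c} Set.univ :=
  Set.InvOn.bijOn (f' := fun w => decode w.1)
    ⟨fun _ hc => FanRecurrent.decode_letterAt hc, fun w _ => PhiF_decode w⟩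
    (fun _ _ => Set.mem_univ _) fun w _ => fanRecurrent_decode w.1

theorem adj_T_iff (w : PMW m) (i : Fin m) :
    (T w).Adj i.castSucc i.succ ↔ w.1 i = Letter.Lm := by
  constructor
  · rintro ⟨j, hj, ⟨h, -⟩ | ⟨h1, h2⟩⟩
    · rwa [Fin.castSucc_injective _ h]
    · have h1 := congrArg Fin.val h1
      have h2 := congrArg Fin.val h2
      simp at h1 h2
      omega
  · exact fun h => ⟨i, h, Or.inl ⟨rfl, rfl⟩⟩

theorem castSucc_mem_verts_T_iff (w : PMW m) (i : Fin m) :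
    i.castSucc ∈ (T w).verts ↔ w.1 i ≠ Letter.R := by
  have : i.castSucc ∈ (T w).verts ↔
      (∃ j : Fin m, i.castSucc = j.castSucc ∧ (w.1 j = Letter.Lu ∨ w.1 j = Letter.Lm)) ∨
        i.castSucc = Fin.last m := Iff.rfl
  rw [this]
  simp only [Fin.castSucc_inj, Fin.castSucc_ne_last, or_false, exists_eq_left']
  cases w.1 i <;> simp

theorem last_mem_verts_T (w : PMW m) : Fin.last m ∈ (T w).verts := Or.inr rfl

open Classical in
/-- The properly marked word of a subgraph of the path. -/
noncomputable def wordOf (H : (SimpleGraph.pathGraph (m + 1)).Subgraph) : PMW m :=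
  ⟨fun i => if H.Adj i.castSucc i.succ then Letter.Lm else
      if i.castSucc ∈ H.verts then Letter.Lu else Letter.R, by
    intro i j hij hi
    have hs : i.succ = j.castSucc := Fin.ext (by simpa using hij)
    have hadj : H.Adj i.castSucc i.succ := by
      by_contra h
      dsimp only at hi
      rw [if_neg h] at hi
      split_ifs at hi
    -- The right end of an edge of `H` is a vertex of `H`, so the next letter is not `R`.
    have := hs ▸ H.edge_vert hadj.symm
    dsimp only
    split_ifs <;> simp⟩

theorem wordOf_T (w : PMW m) : wordOf (T w) = w := by
  refine Subtype.ext (funext fun i => ?_)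
  simp only [wordOf, adj_T_iff, castSucc_mem_verts_T_iff]
  cases w.1 i <;> simp

theorem wordOf_eq_Lm_iff (H : (SimpleGraph.pathGraph (m + 1)).Subgraph) (i : Fin m) :
    (wordOf H).1 i = Letter.Lm ↔ H.Adj i.castSucc i.succ := by
  simp only [wordOf]
  split_ifs <;> simp_all

theorem wordOf_ne_R_iff (H : (SimpleGraph.pathGraph (m + 1)).Subgraph) (i : Fin m) :
    (wordOf H).1 i ≠ Letter.R ↔ i.castSucc ∈ H.verts := by
  simp only [wordOf]
  split_ifs with h h'
  · simpa using H.edge_vert h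
  · simpa
  · simpa

theorem exists_castSucc_succ_of_pathGraph_adj {u v : Fin (m + 1)}
    (h : (SimpleGraph.pathGraph (m + 1)).Adj u v) :
    ∃ i : Fin m, (u = i.castSucc ∧ v = i.succ) ∨ (u = i.succ ∧ v = i.castSucc) := by
  rcases SimpleGraph.pathGraph_adj.1 h with h | h
  · exact ⟨⟨u, by omega⟩, Or.inl ⟨rfl, Fin.ext h.symm⟩⟩
  · exact ⟨⟨v, by omega⟩, Or.inr ⟨Fin.ext h.symm, rfl⟩⟩

/-- No letter records whether the last vertex is present, hence the hypothesis on it. -/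
theorem T_wordOf (H : (SimpleGraph.pathGraph (m + 1)).Subgraph) (hH : Fin.last m ∈ H.verts) :
    T (wordOf H) = H := by
  have hadj (i : Fin m) : (T (wordOf H)).Adj i.castSucc i.succ ↔ H.Adj i.castSucc i.succ := by
    rw [adj_T_iff, wordOf_eq_Lm_iff]
  refine SimpleGraph.Subgraph.ext (Set.ext fun v => ?_) (funext₂ fun u v => propext ?_)
  · cases v using Fin.lastCases with
    | last => exact iff_of_true (last_mem_verts_T _) hH
    | cast i => rw [castSucc_mem_verts_T_iff, wordOf_ne_R_iff]
  · by_cases huv : (SimpleGraph.pathGraph (m + 1)).Adj u v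
    · obtain ⟨i, ⟨rfl, rfl⟩ | ⟨rfl, rfl⟩⟩ := exists_castSucc_succ_of_pathGraph_adj huv
      · exact hadj i
      · rw [SimpleGraph.Subgraph.adj_comm, hadj, SimpleGraph.Subgraph.adj_comm]
    · exact iff_of_false (fun h => huv h.adj_sub) fun h => huv h.adj_sub

theorem bijOn_T : Set.BijOn (T (m := m)) Set.univ {H | Fin.last m ∈ H.verts} :=
  Set.InvOn.bijOn ⟨fun w _ => wordOf_T w, fun H hH => T_wordOf H hH⟩
    (fun w _ => last_mem_verts_T w) fun _ _ => Set.mem_univ _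

end Bijection

/-! ### The level as the number of marks -/

section Level

variable {m : ℕ}

theorem ncard_edgeSet_T (w : PMW m) :
    ((T w).edgeSet.ncard : ℤ) = ∑ i, if w.1 i = Letter.Lm then 1 else 0 := by
  have hinj : Function.Injective fun i : Fin m => s(i.castSucc, i.succ) := by
    intro i j h
    rcases Sym2.eq_iff.1 h with ⟨h, -⟩ | ⟨h1, h2⟩
    · exact Fin.castSucc_injective _ h
    · have h1 := congrArg Fin.val h1
      have h2 := congrArg Fin.val h2
      simp at h1 h2
      omega
  have hset : (T w).edgeSet =
      (fun i : Fin m => s(i.castSucc, i.succ)) '' {i | w.1 i = Letter.Lm} := by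
    ext e
    induction e using Sym2.ind with
    | _ u v =>
      rw [SimpleGraph.Subgraph.mem_edgeSet, Set.mem_image]
      constructor
      · rintro ⟨i, hi, ⟨rfl, rfl⟩ | ⟨rfl, rfl⟩⟩
        · exact ⟨i, hi, rfl⟩
        · exact ⟨i, hi, Sym2.eq_swap⟩
      · rintro ⟨i, hi, h⟩
        rw [← SimpleGraph.Subgraph.mem_edgeSet, ← h]
        exact (adj_T_iff w i).2 hi
  rw [hset, Set.ncard_image_of_injective _ hinj, Set.ncard_eq_toFinset_card']
  simp

theorem FanRecurrent.level_eq {c : Config (Fin (m + 1))} (hc : FanRecurrent c) :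
    level (fanGraph (m + 1)) c = ∑ i, if letterAt c i = Letter.Lm then 1 else 0 := by
  let d : Fin (m + 1) → ℤ := fun k => if edgeDir c k = Dir.left then 1 else 0
  let b : Fin (m + 1) → ℤ := fun k => if Marked c k then 1 else 0
  -- This formula fits all admissible cases: a change of direction accounts for 0 and for the 2
  -- after a rightward edge, the mark for the other 2.
  have hinner (i : Fin m) : (c i.castSucc : ℤ) = 1 + d i.succ - d i.castSucc + b i.castSucc := by
    have h1 := hc.1 i.castSucc
    have h2 := hc.2 i.castSucc
    have h3 : c i.castSucc < 3 := by split_ifs at h1 <;> omega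
    simp only [d, b, edgeDir_succ, Marked, if_neg (Fin.castSucc_ne_last i)]
    rcases hd : edgeDir c i.castSucc with _ | _
    · interval_cases hci : c i.castSucc <;> simp [nextDir]
    · have := h2 hd
      interval_cases hci : c i.castSucc <;> simp_all [nextDir]
  have hlast : (c (Fin.last m) : ℤ) = 1 - d (Fin.last m) + b (Fin.last m) := by
    have h1 := hc.1 (Fin.last m)
    have h2 := hc.2 (Fin.last m)
    have h3 : c (Fin.last m) < 2 := by
      rw [if_pos rfl] at h1
      split_ifs at h1 <;> omega
    simp only [d, b, Marked, if_true]
    rcases hd : edgeDir c (Fin.last m) with _ | _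
    · interval_cases hci : c (Fin.last m) <;> simp
    · have := h2 hd
      interval_cases hci : c (Fin.last m) <;> simp_all
  -- Splitting off the first or the last term of the same sum turns the telescoping into a linear
  -- identity; only `d 0 = 1` and `b 0 = 0` remain at the boundary.
  have hd := (Fin.sum_univ_castSucc d).symm.trans (Fin.sum_univ_succ d)
  have hb := (Fin.sum_univ_castSucc b).symm.trans (Fin.sum_univ_succ b)
  have hd0 : d 0 = 1 := rfl
  have hb0 : b 0 = 0 := if_neg hc.not_marked_zero
  simp_rw [letterAt_eq_Lm_iff]
  rw [level, degree_none_fanGraph, card_edgeFinset_fanGraph, Fin.sum_univ_castSucc]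
  simp_rw [hinner, Finset.sum_add_distrib, Finset.sum_sub_distrib, Finset.sum_add_distrib]
  rw [hlast]
  simp only [Finset.sum_const, Finset.card_univ, Fintype.card_fin, nsmul_eq_mul]
  push_cast
  show _ = ∑ i : Fin m, b i.succ
  linarith

end Level

end Sandpile

open Sandpile in
theorem theorem5p5 (m : ℕ) (μ : PMF (Fin (m + 1))) (hμ : ∀ i, 0 < μ i) :
    Set.BijOn (fun c : Config (Fin (m + 1)) => T (PhiF c))
      (ASMRec (fanGraph (m + 1)) μ)
      {H : (SimpleGraph.pathGraph (m + 1)).Subgraph | Fin.last m ∈ H.verts} ∧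
    ∀ c ∈ ASMRec (fanGraph (m + 1)) μ,
      level (fanGraph (m + 1)) c = ((T (PhiF c)).edgeSet.ncard : ℤ) := by
  have hrec : ASMRec (fanGraph (m + 1)) μ = {c | FanRecurrent c} :=
    Set.ext fun c => mem_ASMRec_fanGraph_iff μ hμ
  rw [hrec]
  refine ⟨bijOn_T.comp bijOn_PhiF, fun c hc => ?_⟩
  rw [ncard_edgeSet_T, FanRecurrent.level_eq hc]
  rfl
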